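/- Let $X$ be a set and let $r\colon X\times X\to X\times X$, $r(x,y)=(\sigma_x(y),\gamma_y(x))$, be a left non-degenerate set-theoretic solution of the Yang--Baxter equation (YBE); that is, $(r\times \mathrm{id})(\mathrm{id}\times r)(r\times \mathrm{id})=(\mathrm{id}\times r)(r\times \mathrm{id})(\mathrm{id}\times r)$ on $X^3$ and every $\sigma_x$ is bijective ($r$ itself need not be bijective). Let $r'(x,y)=(y,\sigma_y\gamma_{\sigma_x^{-1}(y)}(x))$ be the left derived solution. For a map $s\colon X^2\to X^2$, the structure monoid $M(X,s)$ is the monoid generated by $X$ with relations $xy=uv$ whenever $s(x,y)=(u,v)$. Write $M(X,r)$ multiplicatively with operation $\circ$ and $M(X,r')$ additively. Let $\lambda'\colon (M(X,r),\circ)\to\operatorname{Aut}(M(X,r'),+)$ be the left action with $\lambda'_x(y)=\sigma_x(y)$ for $x,y\in X$, and let $\pi\colon M(X,r)\to M(X,r')$ be the bijective $1$-cocycle with respect to $\lambda'$ (that is, $\pi(a\circ b)=\pi(a)+\lambda'_a(\pi(b))$) with $\pi(x)=x$ for $x\in X$. Identify both monoids along $\pi$ to one set $M$ with two operations $+$ and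 $\circ$, so that $a\circ b=a+\lambda'_a(b)$ for all $a,b\in M$. Let $\mu_0=\{(a,b)\in M^2\mid \exists\, c\in M:\ c+a=c+b\}$ and, for $m\ge 0$, let - $\mu_{4m+1}$ be the transitive closure of $\mu_{4m}$, - $\mu_{4m+2}=\{((\lambda'_z)^{\varepsilon}(a\circ c),(\lambda'_z)^{\varepsilon}(b\circ c))\mid z,c\in M,\ \varepsilon\in\{-1,1\},\ (a,b)\in\mu_{4m+1}\}$, - $\mu_{4m+3}$ be the transitive closure of $\mu_{4m+2}$, - $\mu_{4m+4}=\{(c+a+d,c+b+d)\mid c,d\in M,\ (a,b)\in\mu_{4m+3}\}\cup\{(a,b)\in M^2\mid \exists\, c\in M:\ (c+a,c+b)\in\mu_{4m+3}\}$. Let $\mu=\bigcup_{n\ge 0}\mu_n$. It is a congruence on both $(M,+)$ and $(M,\circ)$, and $\bar\lambda_{\bar a}(\bar b)=\overline{\lambda'_a(b)}$ gives a well-defined automorphism $\bar\lambda_{\bar a}$ of $(\bar M,+)$ for each $\bar a\in\bar M$, where $\bar M=M/\mu$ and $a\mapsto\bar a$ is the natural map. Put $\bar\phi(\bar a,\bar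 b)=\bar\lambda_{\bar a}(\bar b)$. Then: 1. $(\bar M,+,\circ,\bar\phi)$ is a left semi-truss, that is, $+$ and $\circ$ are associative on $\bar M$ and $\bar a\circ(\bar b+\bar c)=(\bar a\circ\bar b)+\bar\phi(\bar a,\bar c)$ for all $\bar a,\bar b,\bar c\in\bar M$. Moreover $\bar M+\bar a\subseteq\bar a+\bar M$ for all $\bar a\in\bar M$, and $\bar\phi(\bar a,\bar b)=\bar\lambda_{\bar a}(\bar b)$ for all $\bar a,\bar b\in\bar M$. 2. For all $\bar a,\bar b\in\bar M$ there is a unique element $c(\bar a,\bar b)\in\bar M$ with $\bar a+\bar b=\bar b+c(\bar a,\bar b)$, and the map $$\bar r(\bar a,\bar b)=\bigl(\bar\lambda_{\bar a}(\bar b),\ \bar\lambda^{-1}_{\bar\lambda_{\bar a}(\bar b)}(c(\bar a,\bar\lambda_{\bar a}(\bar b)))\bigr)$$ is a left non-degenerate set-theoretic solution of the YBE on $\bar M$. 3. If $\bar X$ is the image of $X$ in $\bar M$, then $\bar r$ maps $\bar X^2$ into $\bar X^2$, and $(\bar X,\bar r_{|\bar X^2})$ is a left non-degenerate set-theoretic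 solution of the YBE. -/

import Mathlib

universe u

namespace YangBaxter

/-! ### Set-theoretic solutions -/

/-- `r × id` on `X × X × X`. -/
def r12 {X : Type u} (r : X × X → X × X) : X × X × X → X × X × X :=
  fun p => ((r (p.1, p.2.1)).1, (r (p.1, p.2.1)).2, p.2.2)

/-- `id × r` on `X × X × X`. -/
def r23 {X : Type u} (r : X × X → X × X) : X × X × X → X × X × X :=
  fun p => (p.1, r p.2)

/-- `(X, r)` is a set-theoretic solution of the Yang-Baxter equation (`r` need not be bijective). -/
def IsSolution {X : Type u} (r : X × X → X × X) : Prop :=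
  r12 r ∘ r23 r ∘ r12 r = r23 r ∘ r12 r ∘ r23 r

/-- Writing `r (x, y) = (σ_x y, γ_y x)`, every `σ_x` is bijective. -/
def IsLeftNondegenerate {X : Type u} (r : X × X → X × X) : Prop :=
  ∀ x, Function.Bijective fun y => (r (x, y)).1

/-- A left non-degenerate set-theoretic solution of the Yang-Baxter equation on `X`. -/
structure LeftNondegSolution (X : Type u) where
  r : X × X → X × X
  isSolution : IsSolution r
  leftNondeg : IsLeftNondegenerate r

/-- The defining relations `x y = u v`, where `r (x, y) = (u, v)`, of the structure monoid. -/
inductive StructureRel {X : Type u} (r : X × X → X × X) : FreeMonoid X → FreeMonoid X → Prop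
  | intro (x y : X) : StructureRel r (FreeMonoid.of x * FreeMonoid.of y)
      (FreeMonoid.of (r (x, y)).1 * FreeMonoid.of (r (x, y)).2)

/-- The structure monoid `M(X, r)`, written multiplicatively. -/
abbrev StructureMonoid {X : Type u} (r : X × X → X × X) : Type u :=
  PresentedMonoid (StructureRel r)

namespace StructureMonoid

variable {X : Type u} {r : X × X → X × X}

/-- The canonical map `X → M(X, r)`. -/
def of (r : X × X → X × X) (x : X) : StructureMonoid r := PresentedMonoid.of _ x

theorem of_mul_of (x y : X) : of r x * of r y = of r (r (x, y)).1 * of r (r (x, y)).2 :=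
  PresentedMonoid.mk_eq_mk_of_rel (StructureRel.intro x y)

/-- The universal property of `M(X, r)`. -/
def lift {N : Type*} [Monoid N] (f : X → N)
    (h : ∀ x y, f x * f y = f (r (x, y)).1 * f (r (x, y)).2) : StructureMonoid r →* N :=
  PresentedMonoid.lift f (by rintro _ _ ⟨x, y⟩; simpa using h x y)

theorem lift_of {N : Type*} [Monoid N] (f : X → N)
    (h : ∀ x y, f x * f y = f (r (x, y)).1 * f (r (x, y)).2) (x : X) :
    lift f h (of r x) = f x := rfl

theorem induction {p : StructureMonoid r → Prop} (one : p 1)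
    (mul : ∀ x m, p m → p (of r x * m)) (m : StructureMonoid r) : p m := by
  obtain ⟨w, rfl⟩ := PresentedMonoid.surjective_mk m
  induction w using FreeMonoid.inductionOn' with
  | one => exact one
  | of_mul x w ih => exact mul x _ ih

end StructureMonoid

namespace LeftNondegSolution

variable {X : Type u} (S : LeftNondegSolution X)

/-- The bijection `σ_x`. -/
noncomputable def sigma (x : X) : Equiv.Perm X := Equiv.ofBijective _ (S.leftNondeg x)

/-- The map `γ_y`. -/
def gamma (y x : X) : X := (S.r (x, y)).2

theorem r_eq (x y : X) : S.r (x, y) = (S.sigma x y, S.gamma y x) := rfl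

/-- The left derived solution `r'(x, y) = (y, σ_y γ_{σ_x⁻¹(y)}(x))`. -/
noncomputable def derived : X × X → X × X :=
  fun p => (p.2, S.sigma p.2 (S.gamma ((S.sigma p.1).symm p.2) p.1))

theorem ybe (x y z : X) :
    S.sigma x (S.sigma y z) = S.sigma (S.sigma x y) (S.sigma (S.gamma y x) z) ∧
    S.gamma (S.sigma (S.gamma y x) z) (S.sigma x y) =
      S.sigma (S.gamma (S.sigma y z) x) (S.gamma z y) := by
  have h := congrFun S.isSolution (x, y, z)
  simp only [Function.comp_apply, r12, r23, r_eq, Prod.mk.injEq] at h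
  exact ⟨h.1.symm, h.2.1⟩

theorem sigma_mul (x y : X) :
    S.sigma x * S.sigma y = S.sigma (S.sigma x y) * S.sigma (S.gamma y x) :=
  Equiv.ext fun z => (S.ybe x y z).1

/-- The group of permutations of `X` that commute with the left derived solution. -/
def symmGroup : Subgroup (Equiv.Perm X) where
  carrier := {g | ∀ x y, (S.derived (g x, g y)).2 = g (S.derived (x, y)).2}
  mul_mem' := fun {a b} ha hb x y => by
    have h := ha (b x) (b y)
    rw [hb x y] at h
    exact h
  one_mem' := fun _ _ => rfl
  inv_mem' := fun {a} ha x y => by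
    apply a.injective
    rw [← ha]
    simp

theorem sigma_mem (z : X) : S.sigma z ∈ S.symmGroup := by
  intro x y
  obtain ⟨t, rfl⟩ := (S.sigma x).surjective y
  have h : (S.sigma (S.sigma z x)).symm (S.sigma z (S.sigma x t)) = S.sigma (S.gamma x z) t := by
    rw [Equiv.symm_apply_eq, (S.ybe z x t).1]
  simp only [derived, h, Equiv.symm_apply_apply]
  rw [(S.ybe z x t).2, ← (S.ybe z (S.sigma x t) _).1]

/-- `σ_x` as a symmetry of the left derived solution. -/
noncomputable def sig (x : X) : S.symmGroup := ⟨S.sigma x, S.sigma_mem x⟩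

theorem sig_mul (x y : X) :
    S.sig x * S.sig y = S.sig (S.sigma x y) * S.sig (S.gamma y x) :=
  Subtype.ext (S.sigma_mul x y)

/-! ### The additive monoid `M' = M(X, r')` and the action `λ'` -/

/-- `M' = A(X, r) = M(X, r')`, the structure monoid of the left derived solution, written
additively. Below it also receives the multiplication `∘` of `M(X, r)`. -/
def M : Type u := Additive (StructureMonoid S.derived)

instance : AddMonoid S.M := inferInstanceAs (AddMonoid (Additive (StructureMonoid S.derived)))

/-- The canonical map `X → M'`. -/
noncomputable def ι (x : X) : S.M := Additive.ofMul (StructureMonoid.of S.derived x)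

theorem ι_add_ι (x y : X) : S.ι x + S.ι y = S.ι y + S.ι (S.derived (x, y)).2 :=
  StructureMonoid.of_mul_of (r := S.derived) x y

theorem M_induction {p : S.M → Prop} (zero : p 0) (add : ∀ x a, p a → p (S.ι x + a))
    (a : S.M) : p a :=
  StructureMonoid.induction (r := S.derived) (p := p) zero add a

/-- The universal property of `M'`. -/
noncomputable def liftM {N : Type*} [AddMonoid N] (f : X → N)
    (h : ∀ x y, f x + f y = f y + f (S.derived (x, y)).2) : S.M →+ N :=
  MonoidHom.toAdditiveLeft (StructureMonoid.lift (r := S.derived)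
    (fun x => Multiplicative.ofAdd (f x)) h)

theorem liftM_ι {N : Type*} [AddMonoid N] (f : X → N)
    (h : ∀ x y, f x + f y = f y + f (S.derived (x, y)).2) (x : X) :
    S.liftM f h (S.ι x) = f x := rfl

/-- The endomorphism of `M'` induced by a symmetry of the left derived solution. -/
noncomputable def actHom (g : S.symmGroup) : S.M →+ S.M :=
  S.liftM (fun x => S.ι (g.1 x)) (fun x y => by rw [ι_add_ι, g.2 x y])

theorem actHom_ι (g : S.symmGroup) (x : X) : S.actHom g (S.ι x) = S.ι (g.1 x) := rfl

theorem actHom_one (a : S.M) : S.actHom 1 a = a := by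
  induction a using S.M_induction with
  | zero => exact map_zero _
  | add x a ih => rw [map_add, ih, actHom_ι]; rfl

theorem actHom_mul (g h : S.symmGroup) (a : S.M) :
    S.actHom (g * h) a = S.actHom g (S.actHom h a) := by
  induction a using S.M_induction with
  | zero => simp only [map_zero]
  | add x a ih => simp only [map_add, ih, actHom_ι]; rfl

/-- The automorphism of `M'` induced by a symmetry of the left derived solution. -/
noncomputable def act (g : S.symmGroup) : S.M ≃+ S.M where
  toFun := S.actHom g
  invFun := S.actHom g⁻¹
  left_inv := fun a => by rw [← actHom_mul, inv_mul_cancel, actHom_one]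
  right_inv := fun a => by rw [← actHom_mul, mul_inv_cancel, actHom_one]
  map_add' := map_add _

/-- The homomorphism from `M(X, r)` to permutations of `X` with `x ↦ σ_x`. -/
noncomputable def sigHom : StructureMonoid S.r →* S.symmGroup :=
  StructureMonoid.lift S.sig S.sig_mul

/-- The left action `λ' : M(X, r) → Aut(M', +)` with `λ'_x(y) = σ_x(y)` for `x, y ∈ X`. -/
noncomputable def lam' (m : StructureMonoid S.r) : S.M ≃+ S.M := S.act (S.sigHom m)

theorem lam'_of_ι (x y : X) : S.lam' (StructureMonoid.of S.r x) (S.ι y) = S.ι (S.sigma x y) := rfl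

theorem lam'_one (a : S.M) : S.lam' 1 a = a := by
  change S.actHom (S.sigHom 1) a = a
  rw [map_one, actHom_one]

theorem lam'_mul (m n : StructureMonoid S.r) (a : S.M) :
    S.lam' (m * n) a = S.lam' m (S.lam' n a) := by
  change S.actHom (S.sigHom (m * n)) a = _
  rw [map_mul, actHom_mul]; rfl

/-! ### The bijective 1-cocycle `π : M(X, r) → M'` -/

/-- The affine action of `M(X, r)` on `M'`: a generator `x` sends `b` to `x + λ'_x(b)`. -/
noncomputable def affine : StructureMonoid S.r →* Function.End S.M :=
  StructureMonoid.lift (fun x b => S.ι x + S.lam' (StructureMonoid.of S.r x) b) (fun x y => by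
    funext b
    change S.ι x + S.lam' _ (S.ι y + S.lam' _ b) = S.ι _ + S.lam' _ (S.ι _ + S.lam' _ b)
    rw [map_add, map_add, ← add_assoc, ← add_assoc, ← lam'_mul, ← lam'_mul,
      StructureMonoid.of_mul_of, lam'_of_ι, lam'_of_ι, ι_add_ι]
    simp [derived, r_eq])

/-- The map `π : M(X, r) → M'`. -/
noncomputable def cocycle (m : StructureMonoid S.r) : S.M := S.affine m 0

theorem affine_apply (m : StructureMonoid S.r) (b : S.M) :
    S.affine m b = S.cocycle m + S.lam' m b := by
  induction m using StructureMonoid.induction with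
  | one =>
    rw [cocycle, map_one, lam'_one]
    exact (zero_add b).symm
  | mul x m ih =>
    have h : ∀ c, S.affine (StructureMonoid.of S.r x * m) c =
        S.ι x + S.lam' (StructureMonoid.of S.r x) (S.affine m c) := fun c => by
      rw [map_mul]; rfl
    rw [cocycle, h, h, ih, map_add, lam'_mul, ← add_assoc]
    rfl

/-- `π` is a 1-cocycle with respect to `λ'`. -/
theorem cocycle_mul (m n : StructureMonoid S.r) :
    S.cocycle (m * n) = S.cocycle m + S.lam' m (S.cocycle n) := by
  rw [← affine_apply, cocycle, map_mul]; rfl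

theorem cocycle_one : S.cocycle 1 = 0 := by
  rw [cocycle, map_one]; rfl

theorem cocycle_of (x : X) : S.cocycle (StructureMonoid.of S.r x) = S.ι x := by
  change S.ι x + S.lam' _ 0 = _
  rw [map_zero, add_zero]

/-- An auxiliary action of `M'`, used to invert `π`. -/
noncomputable def aux : S.M →+ Additive (Function.End (S.symmGroup → StructureMonoid S.r)) :=
  S.liftM (fun x => Additive.ofMul fun f g =>
    StructureMonoid.of S.r (g.1 x) * f ((S.sig (g.1 x))⁻¹ * g)) (fun x y => by
    apply Additive.toMul.injective
    funext f g
    change StructureMonoid.of S.r (g.1 x) *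
        (StructureMonoid.of S.r (((S.sig (g.1 x))⁻¹ * g).1 y) * f _) =
      StructureMonoid.of S.r (g.1 y) *
        (StructureMonoid.of S.r (((S.sig (g.1 y))⁻¹ * g).1 (S.derived (x, y)).2) * f _)
    obtain ⟨t, ht⟩ := (S.sigma (g.1 x)).surjective (g.1 y)
    have h1 : ((S.sig (g.1 x))⁻¹ * g).1 y = t := by
      change (S.sigma (g.1 x)).symm (g.1 y) = t
      rw [← ht, Equiv.symm_apply_apply]
    have h2 : ((S.sig (g.1 y))⁻¹ * g).1 (S.derived (x, y)).2 = S.gamma t (g.1 x) := by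
      change (S.sigma (g.1 y)).symm (g.1 (S.derived (x, y)).2) = _
      rw [← g.2 x y]
      simp [derived, ← ht]
    have h3 := StructureMonoid.of_mul_of (r := S.r) (g.1 x) t
    rw [r_eq, ht] at h3
    have h4 : (S.sig t)⁻¹ * ((S.sig (g.1 x))⁻¹ * g) =
        (S.sig (S.gamma t (g.1 x)))⁻¹ * ((S.sig (g.1 y))⁻¹ * g) := by
      rw [← mul_assoc, ← mul_assoc, ← mul_inv_rev, ← mul_inv_rev, sig_mul, ht]
    rw [h1, h2, h4, ← mul_assoc (StructureMonoid.of S.r (g.1 x)), h3, mul_assoc])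

/-- `auxFun a g` is `π⁻¹(g • a)`. -/
noncomputable def auxFun (a : S.M) (g : S.symmGroup) : StructureMonoid S.r :=
  Additive.toMul (S.aux a) (fun _ => 1) g

theorem auxFun_zero (g : S.symmGroup) : S.auxFun 0 g = 1 := by
  rw [auxFun, map_zero]; rfl

theorem auxFun_ι_add (x : X) (a : S.M) (g : S.symmGroup) :
    S.auxFun (S.ι x + a) g =
      StructureMonoid.of S.r (g.1 x) * S.auxFun a ((S.sig (g.1 x))⁻¹ * g) := by
  rw [auxFun, map_add]; rfl

theorem cocycle_auxFun (a : S.M) (g : S.symmGroup) : S.cocycle (S.auxFun a g) = S.actHom g a := by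
  induction a using S.M_induction generalizing g with
  | zero => rw [auxFun_zero, cocycle_one, map_zero]
  | add x a ih =>
    rw [auxFun_ι_add, cocycle_mul, ih, cocycle_of, map_add, actHom_ι]
    change _ + S.actHom (S.sig _) _ = _
    rw [← actHom_mul, mul_inv_cancel_left]

theorem auxFun_act (a : S.M) (g h : S.symmGroup) :
    S.auxFun (S.actHom h a) g = S.auxFun a (g * h) := by
  induction a using S.M_induction generalizing g with
  | zero => rw [map_zero, auxFun_zero, auxFun_zero]
  | add x a ih =>
    rw [map_add, actHom_ι, auxFun_ι_add, auxFun_ι_add, ih, mul_assoc]; rfl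

theorem auxFun_cocycle (m : StructureMonoid S.r) : S.auxFun (S.cocycle m) 1 = m := by
  induction m using StructureMonoid.induction with
  | one => rw [cocycle_one, auxFun_zero]
  | mul x m ih =>
    rw [cocycle_mul, cocycle_of, auxFun_ι_add]
    change _ * S.auxFun (S.actHom (S.sig x) _) _ = _
    rw [auxFun_act]
    have h : (S.sig ((1 : S.symmGroup).1 x))⁻¹ * 1 * S.sig x = 1 := by
      rw [mul_one]; exact inv_mul_cancel _
    rw [h, ih]; rfl

/-- The bijective 1-cocycle `π : M(X, r) → M'` with `π(x) = x` for `x ∈ X`. -/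
noncomputable def π : StructureMonoid S.r ≃ S.M where
  toFun := S.cocycle
  invFun := fun a => S.auxFun a 1
  left_inv := S.auxFun_cocycle
  right_inv := fun a => by rw [cocycle_auxFun, actHom_one]

/-! ### The identification of `M(X, r)` with `M'` -/

/-- The multiplication `∘` of `M(X, r)`, transported to `M'` along `π`; it is written `*`. -/
noncomputable instance : Monoid S.M := S.π.symm.monoid

/-- `λ'_a` for `a ∈ M`, after the identification of `M(X, r)` with `M'` along `π`. -/
noncomputable def lam (a : S.M) : S.M ≃+ S.M := S.lam' (S.π.symm a)

theorem mul_def (a b : S.M) : a * b = S.π (S.π.symm a * S.π.symm b) := rfl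

theorem mul_eq (a b : S.M) : a * b = a + S.lam a b := by
  have h := S.cocycle_mul (S.π.symm a) (S.π.symm b)
  change S.π _ = S.π _ + S.lam' _ (S.π _) at h
  rw [Equiv.apply_symm_apply, Equiv.apply_symm_apply] at h
  exact h

theorem one_eq_zero : (1 : S.M) = 0 := S.cocycle_one

theorem lam_one (a : S.M) : S.lam 1 a = a := by
  have h : S.π.symm 1 = 1 := S.π.symm_apply_apply 1
  rw [lam, h, lam'_one]

theorem lam_ι (x y : X) : S.lam (S.ι x) (S.ι y) = S.ι (S.sigma x y) := by
  have h : S.π.symm (S.ι x) = StructureMonoid.of S.r x := by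
    rw [Equiv.symm_apply_eq]; exact (S.cocycle_of x).symm
  rw [lam, h, lam'_of_ι]

/-! ### The congruence `μ` -/

/-- `μ₀`. -/
def muBase (a b : S.M) : Prop := ∃ c, c + a = c + b

/-- All pairs `((λ'_z)^ε (a ∘ c), (λ'_z)^ε (b ∘ c))` with `R a b` and `ε = 1` or `ε = -1`. -/
def muMul (R : S.M → S.M → Prop) (u v : S.M) : Prop :=
  ∃ z c a b, R a b ∧
    ((u = S.lam z (a * c) ∧ v = S.lam z (b * c)) ∨
      (u = (S.lam z).symm (a * c) ∧ v = (S.lam z).symm (b * c)))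

/-- All pairs `(c + a + d, c + b + d)` with `R a b`, and all `(a, b)` with `R (c + a) (c + b)`
for some `c`. -/
def muAdd (R : S.M → S.M → Prop) (u v : S.M) : Prop :=
  (∃ c d a b, R a b ∧ u = c + a + d ∧ v = c + b + d) ∨ ∃ c, R (c + u) (c + v)

/-- The relations `μ_n`: `μ_{4m+1}` and `μ_{4m+3}` are the transitive closures of their
predecessors, `μ_{4m+2}` arises from `μ_{4m+1}` by `muMul`, and `μ_{4m+4}` from `μ_{4m+3}` by
`muAdd`. -/
def muSeq : ℕ → S.M → S.M → Prop
  | 0 => S.muBase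
  | n + 1 =>
    if n % 4 = 1 then S.muMul (muSeq n)
    else if n % 4 = 3 then S.muAdd (muSeq n)
    else Relation.TransGen (muSeq n)

/-- `μ`, the union of all `μ_n`. -/
def mu (a b : S.M) : Prop := ∃ n, S.muSeq n a b

theorem muSeq_succ_of_one {n : ℕ} (h : n % 4 = 1) :
    S.muSeq (n + 1) = S.muMul (S.muSeq n) := by rw [muSeq, if_pos h]

theorem muSeq_succ_of_three {n : ℕ} (h : n % 4 = 3) :
    S.muSeq (n + 1) = S.muAdd (S.muSeq n) := by
  rw [muSeq, if_neg (by omega), if_pos h]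

theorem muSeq_succ_of_even {n : ℕ} (h : n % 2 = 0) :
    S.muSeq (n + 1) = Relation.TransGen (S.muSeq n) := by
  rw [muSeq, if_neg (by omega), if_neg (by omega)]

theorem muSeq_le_succ (n : ℕ) {a b : S.M} (h : S.muSeq n a b) : S.muSeq (n + 1) a b := by
  by_cases h1 : n % 4 = 1
  · rw [muSeq_succ_of_one S h1]
    exact ⟨1, 1, a, b, h, Or.inl (by simp only [mul_one, lam_one, and_self])⟩
  by_cases h3 : n % 4 = 3
  · rw [muSeq_succ_of_three S h3]
    exact Or.inr ⟨0, by simpa only [zero_add] using h⟩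
  · rw [muSeq_succ_of_even S (by omega)]
    exact Relation.TransGen.single h

theorem muSeq_mono {m n : ℕ} (hmn : m ≤ n) {a b : S.M} (h : S.muSeq m a b) :
    S.muSeq n a b := by
  induction hmn with
  | refl => exact h
  | step _ ih => exact S.muSeq_le_succ _ ih

theorem muSeq_symm (n : ℕ) {a b : S.M} (h : S.muSeq n a b) : S.muSeq n b a := by
  induction n generalizing a b with
  | zero => exact h.imp fun _ hc => hc.symm
  | succ n ih =>
    by_cases h1 : n % 4 = 1
    · rw [muSeq_succ_of_one S h1] at h ⊢
      obtain ⟨z, c, u, v, huv, h⟩ := h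
      exact ⟨z, c, v, u, ih huv, h.imp And.symm And.symm⟩
    by_cases h3 : n % 4 = 3
    · rw [muSeq_succ_of_three S h3] at h ⊢
      rcases h with ⟨c, d, u, v, huv, h⟩ | ⟨c, h⟩
      · exact Or.inl ⟨c, d, v, u, ih huv, h.symm⟩
      · exact Or.inr ⟨c, ih h⟩
    · rw [muSeq_succ_of_even S (by omega)] at h ⊢
      exact Relation.transGen_swap.1 (Relation.TransGen.mono (fun _ _ => ih) _ _ h)

theorem mu_refl (a : S.M) : S.mu a a := ⟨0, 0, rfl⟩

theorem mu_symm {a b : S.M} (h : S.mu a b) : S.mu b a :=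
  h.imp fun n => S.muSeq_symm n

theorem mu_trans {a b c : S.M} (h : S.mu a b) (h' : S.mu b c) : S.mu a c := by
  obtain ⟨m, hm⟩ := h
  obtain ⟨n, hn⟩ := h'
  refine ⟨2 * (m + n) + 1, ?_⟩
  rw [muSeq_succ_of_even S (by omega)]
  exact .tail (.single (S.muSeq_mono (by omega) hm)) (S.muSeq_mono (by omega) hn)

theorem mu_add_add {a b : S.M} (h : S.mu a b) (c d : S.M) : S.mu (c + a + d) (c + b + d) := by
  obtain ⟨n, hn⟩ := h
  refine ⟨4 * n + 3 + 1, ?_⟩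
  rw [muSeq_succ_of_three S (by omega)]
  exact Or.inl ⟨c, d, a, b, S.muSeq_mono (by omega) hn, rfl, rfl⟩

theorem mu_cancel {a b c : S.M} (h : S.mu (c + a) (c + b)) : S.mu a b := by
  obtain ⟨n, hn⟩ := h
  refine ⟨4 * n + 3 + 1, ?_⟩
  rw [muSeq_succ_of_three S (by omega)]
  exact Or.inr ⟨c, S.muSeq_mono (by omega) hn⟩

theorem mu_muMul {u v : S.M} (h : S.muMul S.mu u v) : S.mu u v := by
  obtain ⟨z, c, a, b, ⟨n, hn⟩, h⟩ := h
  refine ⟨4 * n + 1 + 1, ?_⟩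
  rw [muSeq_succ_of_one S (by omega)]
  exact ⟨z, c, a, b, S.muSeq_mono (by omega) hn, h⟩

theorem mu_add {a b c d : S.M} (h : S.mu a b) (h' : S.mu c d) : S.mu (a + c) (b + d) := by
  have h1 := S.mu_add_add h 0 c
  have h2 := S.mu_add_add h' b 0
  simp only [zero_add, add_zero] at h1 h2
  exact S.mu_trans h1 h2

theorem mu_lam_right (z : S.M) {a b : S.M} (h : S.mu a b) : S.mu (S.lam z a) (S.lam z b) :=
  S.mu_muMul ⟨z, 1, a, b, h, Or.inl (by simp only [mul_one, and_self])⟩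

theorem mu_lam_symm_right (z : S.M) {a b : S.M} (h : S.mu a b) :
    S.mu ((S.lam z).symm a) ((S.lam z).symm b) :=
  S.mu_muMul ⟨z, 1, a, b, h, Or.inr (by simp only [mul_one, and_self])⟩

theorem mu_lam_left {c d : S.M} (h : S.mu c d) (a : S.M) : S.mu (S.lam c a) (S.lam d a) := by
  have h1 : S.mu (c * a) (d * a) :=
    S.mu_muMul ⟨1, a, c, d, h, Or.inl (by simp only [lam_one, and_self])⟩
  rw [mul_eq, mul_eq] at h1
  exact S.mu_cancel (S.mu_trans h1 (S.mu_add (S.mu_symm h) (S.mu_refl _)))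

theorem mu_lam {a b c d : S.M} (h : S.mu a b) (h' : S.mu c d) :
    S.mu (S.lam a c) (S.lam b d) :=
  S.mu_trans (S.mu_lam_left h c) (S.mu_lam_right b h')

theorem mu_lam_symm {a b c d : S.M} (h : S.mu a b) (h' : S.mu c d) :
    S.mu ((S.lam a).symm c) ((S.lam b).symm d) := by
  have h1 := S.mu_lam_symm_right b (S.mu_lam_left h ((S.lam a).symm c))
  simp only [AddEquiv.apply_symm_apply, AddEquiv.symm_apply_apply] at h1
  exact S.mu_trans (S.mu_symm h1) (S.mu_lam_symm_right b h')

theorem mu_mul {a b c d : S.M} (h : S.mu a b) (h' : S.mu c d) : S.mu (a * c) (b * d) := by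
  rw [mul_eq, mul_eq]
  exact S.mu_add h (S.mu_lam h h')

/-- `μ` as an equivalence relation on `M`. -/
def muSetoid : Setoid S.M := ⟨S.mu, S.mu_refl, S.mu_symm, S.mu_trans⟩

/-! ### The quotient `M̄ = M / μ` -/

/-- `M̄ = M / μ`. -/
def Mbar : Type u := Quotient S.muSetoid

/-- The natural map `M → M̄`. -/
def toMbar (a : S.M) : S.Mbar := Quotient.mk S.muSetoid a

instance : Add S.Mbar :=
  ⟨Quotient.map₂ (· + ·) fun _ _ h _ _ h' => S.mu_add h h'⟩

/-- The operation `∘` on `M̄`. -/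
noncomputable instance : Mul S.Mbar :=
  ⟨Quotient.map₂ (· * ·) fun _ _ h _ _ h' => S.mu_mul h h'⟩

/-- `λ̄`, given by `λ̄_ā(b̄) = \overline{λ'_a(b)}`, with inverse
`λ̄_ā⁻¹(b̄) = \overline{(λ'_a)⁻¹(b)}`. -/
noncomputable def lamBar (a : S.Mbar) : S.Mbar ≃+ S.Mbar where
  toFun := Quotient.map₂ (fun a b => S.lam a b) (fun _ _ h _ _ h' => S.mu_lam h h') a
  invFun := Quotient.map₂ (fun a b => (S.lam a).symm b) (fun _ _ h _ _ h' => S.mu_lam_symm h h') a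
  left_inv := fun b => Quotient.inductionOn₂ a b fun a b =>
    congrArg S.toMbar ((S.lam a).symm_apply_apply b)
  right_inv := fun b => Quotient.inductionOn₂ a b fun a b =>
    congrArg S.toMbar ((S.lam a).apply_symm_apply b)
  map_add' := fun b c => Quotient.inductionOn₃ a b c fun a b c =>
    congrArg S.toMbar (map_add (S.lam a) b c)

theorem toMbar_add (a b : S.M) : S.toMbar (a + b) = S.toMbar a + S.toMbar b := rfl

theorem toMbar_mul (a b : S.M) : S.toMbar (a * b) = S.toMbar a * S.toMbar b := rfl

theorem lamBar_toMbar (a b : S.M) :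
    S.lamBar (S.toMbar a) (S.toMbar b) = S.toMbar (S.lam a b) := rfl

/-- The map `φ̄` of the semi-truss `M̄`. -/
noncomputable def phiBar (a b : S.Mbar) : S.Mbar := S.lamBar a b

/-- The element `c(ā, b̄)`, that is, the element `c̄` with `ā + b̄ = b̄ + c̄`. -/
noncomputable def cBar (a b : S.Mbar) : S.Mbar :=
  @Classical.epsilon S.Mbar ⟨a⟩ fun c => a + b = b + c

/-- The map `r̄`. -/
noncomputable def rBar : S.Mbar × S.Mbar → S.Mbar × S.Mbar :=
  fun p => (S.lamBar p.1 p.2, (S.lamBar (S.lamBar p.1 p.2)).symm (S.cBar p.1 (S.lamBar p.1 p.2)))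

/-- The image `X̄` of `X` in `M̄`. -/
def Xbar : Set S.Mbar := Set.range fun x => S.toMbar (S.ι x)

end LeftNondegSolution

/-- A left semi-truss `(A, +, ∘, φ)`, with `∘` written `*`. -/
structure IsLeftSemiTruss (A : Type u) [Add A] [Mul A] (φ : A → A → A) : Prop where
  add_assoc : ∀ a b c : A, a + b + c = a + (b + c)
  mul_assoc : ∀ a b c : A, a * b * c = a * (b * c)
  mul_add : ∀ a b c : A, a * (b + c) = a * b + φ a c

end YangBaxter

namespace YangBaxter

/-! The relations x + y = y + r'(x,y)₂ let any b be pulled to the left of any a, so a + b ∈ b + M,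
and this passes to M̄. Since μ is closed under left cancellation, M̄ is left cancellative, so the
remainder c(a,b) in a + b = b + c(a,b) is unique. Identities for c then follow by comparing sums:
automorphisms of (M̄,+) commute with c, and c is self-distributive (`lamBar_cBar`, `cBar_cBar`).

Write r̄(a,b) = (λ_a(b), ρ_b(a)). The choice of ρ makes r̄ preserve the product: λ_a(b) ∘ ρ_b(a) = a
∘ b (`lamBar_mul_rhoBar`). As λ is multiplicative, this gives the first component of the YBE. The
other two are checked after applying suitable bijections λ, which turn every ρ into c: the second
becomes equivariance of c, the third its self-distributivity. On generators, λ and c are given by σ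
and the derived solution, so everything restricts to X̄. -/

/-- A map that embeds equivariantly into a solution is itself a solution. -/
theorem IsSolution.of_injective {Y Z : Type u} {s : Y × Y → Y × Y} {r : Z × Z → Z × Z}
    (hr : IsSolution r) (f : Y → Z) (hf : Function.Injective f)
    (h : ∀ x y, r (f x, f y) = (f (s (x, y)).1, f (s (x, y)).2)) : IsSolution s := by
  funext ⟨x, y, z⟩
  have e := congrFun hr (f x, f y, f z)
  simp only [Function.comp_apply, r12, r23, h, Prod.mk.injEq] at e
  exact Prod.ext (hf e.1) (Prod.ext (hf e.2.1) (hf e.2.2))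

namespace LeftNondegSolution

variable {X : Type u} (S : LeftNondegSolution X)

/-! ### Normality of `(M, +)` and multiplicativity of the action -/

theorem exists_add_ι_eq (a : S.M) (y : X) : ∃ c, a + S.ι y = S.ι y + c := by
  induction a using S.M_induction with
  | zero => exact ⟨0, by rw [zero_add, add_zero]⟩
  | add x a ih =>
    obtain ⟨c, hc⟩ := ih
    exact ⟨S.ι (S.derived (x, y)).2 + c, by rw [add_assoc, hc, ← add_assoc, ι_add_ι, add_assoc]⟩

/-- The generators of b are pulled to the front one at a time. Each changes the remainder, so the
induction on b keeps a arbitrary. -/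
theorem exists_add_eq_add (a b : S.M) : ∃ c, a + b = b + c := by
  induction b using S.M_induction generalizing a with
  | zero => exact ⟨a, by rw [zero_add, add_zero]⟩
  | add y b ih =>
    obtain ⟨c, hc⟩ := S.exists_add_ι_eq a y
    obtain ⟨d, hd⟩ := ih c
    exact ⟨d, by rw [← add_assoc, hc, add_assoc, hd, add_assoc]⟩

theorem lam_mul (a b c : S.M) : S.lam (a * b) c = S.lam a (S.lam b c) := by
  rw [mul_def, lam, Equiv.symm_apply_apply, lam'_mul]; rfl

theorem lam_ι_symm_ι (x y : X) :
    (S.lam (S.ι x)).symm (S.ι y) = S.ι ((S.sigma x).symm y) := by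
  rw [AddEquiv.symm_apply_eq, lam_ι, Equiv.apply_symm_apply]

/-! ### The operations of `M̄` -/

theorem toMbar_surjective : Function.Surjective S.toMbar := Quotient.exists_rep

theorem Mbar_add_assoc (a b c : S.Mbar) : a + b + c = a + (b + c) :=
  Quotient.inductionOn₃ a b c fun a b c => congrArg S.toMbar (add_assoc a b c)

theorem Mbar_mul_assoc (a b c : S.Mbar) : a * b * c = a * (b * c) :=
  Quotient.inductionOn₃ a b c fun a b c => congrArg S.toMbar (mul_assoc a b c)

theorem Mbar_mul_eq (a b : S.Mbar) : a * b = a + S.lamBar a b :=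
  Quotient.inductionOn₂ a b fun a b => congrArg S.toMbar (S.mul_eq a b)

theorem lamBar_mul (a b c : S.Mbar) : S.lamBar (a * b) c = S.lamBar a (S.lamBar b c) :=
  Quotient.inductionOn₃ a b c fun a b c => congrArg S.toMbar (S.lam_mul a b c)

/-- This is what the cancellation clause in the steps μ_{4m+4} is for. -/
theorem Mbar_add_left_cancel {a b c : S.Mbar} (h : a + b = a + c) : b = c := by
  obtain ⟨a, rfl⟩ := S.toMbar_surjective a
  obtain ⟨b, rfl⟩ := S.toMbar_surjective b
  obtain ⟨c, rfl⟩ := S.toMbar_surjective c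
  exact Quotient.sound (s := S.muSetoid) (S.mu_cancel (Quotient.exact (s := S.muSetoid) h))

theorem isLeftSemiTruss_Mbar : IsLeftSemiTruss S.Mbar S.phiBar where
  add_assoc := S.Mbar_add_assoc
  mul_assoc := S.Mbar_mul_assoc
  mul_add a b c := by
    rw [Mbar_mul_eq, Mbar_mul_eq, map_add, Mbar_add_assoc, phiBar]

theorem Mbar_exists_add_eq_add (a b : S.Mbar) : ∃ c, a + b = b + c := by
  obtain ⟨a, rfl⟩ := S.toMbar_surjective a
  obtain ⟨b, rfl⟩ := S.toMbar_surjective b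
  obtain ⟨c, hc⟩ := S.exists_add_eq_add a b
  exact ⟨S.toMbar c, congrArg S.toMbar hc⟩

/-! ### The map `c` -/

theorem add_cBar (a b : S.Mbar) : b + S.cBar a b = a + b :=
  -- A remainder exists, so the default value of `epsilon` plays no role.
  (@Classical.epsilon_spec _ (fun c => a + b = b + c) (S.Mbar_exists_add_eq_add a b)).symm

theorem cBar_eq {a b c : S.Mbar} (h : a + b = b + c) : S.cBar a b = c :=
  S.Mbar_add_left_cancel ((S.add_cBar a b).trans h)

/-- An additive automorphism carries the equation defining c(a,b) to the one defining its image;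
uniqueness does the rest. -/
theorem lamBar_cBar (z a b : S.Mbar) :
    S.lamBar z (S.cBar a b) = S.cBar (S.lamBar z a) (S.lamBar z b) :=
  (S.cBar_eq (by rw [← map_add, ← map_add, add_cBar])).symm

/-- Moving a past b + d amounts to moving it past b, then moving the remainder past d. -/
theorem cBar_add (a b d : S.Mbar) : S.cBar a (b + d) = S.cBar (S.cBar a b) d :=
  S.cBar_eq (by
    rw [← Mbar_add_assoc, ← S.add_cBar a b, Mbar_add_assoc, ← S.add_cBar (S.cBar a b) d,
      Mbar_add_assoc])

/-- Both sides are c(a, b + d), computed along the two decompositions b + d = d + c(b,d). -/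
theorem cBar_cBar (a b d : S.Mbar) :
    S.cBar (S.cBar a b) d = S.cBar (S.cBar a d) (S.cBar b d) := by
  rw [← cBar_add, ← cBar_add, add_cBar]

theorem cBar_ι (x y : X) :
    S.cBar (S.toMbar (S.ι x)) (S.toMbar (S.ι y)) = S.toMbar (S.ι (S.derived (x, y)).2) :=
  S.cBar_eq (congrArg S.toMbar (S.ι_add_ι x y))

/-! ### The solution `r̄` -/

/-- The second component of `r̄(ā, b̄)`. -/
noncomputable def rhoBar (b a : S.Mbar) : S.Mbar :=
  (S.lamBar (S.lamBar a b)).symm (S.cBar a (S.lamBar a b))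

theorem rBar_eq (a b : S.Mbar) : S.rBar (a, b) = (S.lamBar a b, S.rhoBar b a) := rfl

theorem lamBar_rhoBar (a b : S.Mbar) :
    S.lamBar (S.lamBar a b) (S.rhoBar b a) = S.cBar a (S.lamBar a b) :=
  AddEquiv.apply_symm_apply _ _

/-- With u = λ_a(b), the left side is u + c(a,u) = a + u. -/
theorem lamBar_mul_rhoBar (a b : S.Mbar) : S.lamBar a b * S.rhoBar b a = a * b := by
  rw [Mbar_mul_eq, lamBar_rhoBar, add_cBar, Mbar_mul_eq]

theorem lamBar_lamBar_rhoBar (a b d : S.Mbar) :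
    S.lamBar (S.lamBar a b) (S.lamBar (S.rhoBar b a) d) = S.lamBar a (S.lamBar b d) := by
  rw [← lamBar_mul, lamBar_mul_rhoBar, lamBar_mul]

theorem rhoBar_lamBar (a b d : S.Mbar) :
    S.rhoBar (S.lamBar (S.rhoBar b a) d) (S.lamBar a b) =
      S.lamBar (S.rhoBar (S.lamBar b d) a) (S.rhoBar d b) := by
  -- Under this λ both sides become c(λ_a b, λ_a λ_b d).
  apply (S.lamBar (S.lamBar a (S.lamBar b d))).injective
  rw [lamBar_lamBar_rhoBar, lamBar_rhoBar, lamBar_cBar, ← S.lamBar_lamBar_rhoBar a b d,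
    lamBar_rhoBar]

theorem rhoBar_rhoBar (a b d : S.Mbar) :
    S.rhoBar d (S.rhoBar b a) = S.rhoBar (S.rhoBar d b) (S.rhoBar (S.lamBar b d) a) := by
  apply (S.lamBar (S.lamBar (S.rhoBar (S.lamBar b d) a) (S.rhoBar d b))).injective
  apply (S.lamBar (S.lamBar a (S.lamBar b d))).injective
  -- With p = λ_a λ_b d and q = λ_a b, the right side becomes c(c(a,p), c(q,p)) and the left side
  -- c(c(a,q), p).
  rw [lamBar_rhoBar, lamBar_cBar, lamBar_rhoBar, lamBar_lamBar_rhoBar, lamBar_rhoBar,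
    lamBar_cBar, ← cBar_cBar, ← rhoBar_lamBar, ← S.lamBar_lamBar_rhoBar a b d,
    lamBar_lamBar_rhoBar, lamBar_rhoBar, lamBar_cBar, lamBar_rhoBar]

theorem isSolution_rBar : IsSolution S.rBar := by
  funext ⟨a, b, d⟩
  simp only [Function.comp_apply, r12, r23, rBar_eq, Prod.mk.injEq]
  exact ⟨S.lamBar_lamBar_rhoBar a b d, S.rhoBar_lamBar a b d, S.rhoBar_rhoBar a b d⟩

theorem isLeftNondegenerate_rBar : IsLeftNondegenerate S.rBar :=
  fun a => (S.lamBar a).bijective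

/-! ### The restriction to `X̄` -/

theorem lamBar_mem_Xbar {a b : S.Mbar} (ha : a ∈ S.Xbar) (hb : b ∈ S.Xbar) :
    S.lamBar a b ∈ S.Xbar := by
  obtain ⟨x, rfl⟩ := ha
  obtain ⟨y, rfl⟩ := hb
  exact ⟨S.sigma x y, congrArg S.toMbar (S.lam_ι x y).symm⟩

/-- Needed separately because X̄ may be infinite: λ_a mapping X̄ into itself does not make the
restriction surjective. -/
theorem lamBar_symm_mem_Xbar {a b : S.Mbar} (ha : a ∈ S.Xbar) (hb : b ∈ S.Xbar) :
    (S.lamBar a).symm b ∈ S.Xbar := by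
  obtain ⟨x, rfl⟩ := ha
  obtain ⟨y, rfl⟩ := hb
  exact ⟨(S.sigma x).symm y, congrArg S.toMbar (S.lam_ι_symm_ι x y).symm⟩

theorem cBar_mem_Xbar {a b : S.Mbar} (ha : a ∈ S.Xbar) (hb : b ∈ S.Xbar) :
    S.cBar a b ∈ S.Xbar := by
  obtain ⟨x, rfl⟩ := ha
  obtain ⟨y, rfl⟩ := hb
  exact ⟨(S.derived (x, y)).2, (S.cBar_ι x y).symm⟩

theorem rhoBar_mem_Xbar {a b : S.Mbar} (ha : a ∈ S.Xbar) (hb : b ∈ S.Xbar) :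
    S.rhoBar b a ∈ S.Xbar :=
  S.lamBar_symm_mem_Xbar (S.lamBar_mem_Xbar ha hb)
    (S.cBar_mem_Xbar ha (S.lamBar_mem_Xbar ha hb))

/-- The restriction of `r̄` to `X̄ × X̄`. -/
noncomputable def rBarRestrict : S.Xbar × S.Xbar → S.Xbar × S.Xbar := fun p =>
  (⟨S.lamBar p.1 p.2, S.lamBar_mem_Xbar p.1.2 p.2.2⟩,
    ⟨S.rhoBar p.2 p.1, S.rhoBar_mem_Xbar p.1.2 p.2.2⟩)

theorem isLeftNondegenerate_rBarRestrict : IsLeftNondegenerate S.rBarRestrict := by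
  refine fun x => ⟨fun y z h => ?_, fun y => ?_⟩
  · exact Subtype.ext ((S.lamBar x).injective (congrArg Subtype.val h))
  · exact ⟨⟨(S.lamBar x).symm y, S.lamBar_symm_mem_Xbar x.2 y.2⟩,
      Subtype.ext ((S.lamBar x).apply_symm_apply y)⟩

end LeftNondegSolution

end YangBaxter

theorem mainTheorem2 {X : Type u} (S : YangBaxter.LeftNondegSolution X) :
    YangBaxter.IsLeftSemiTruss S.Mbar S.phiBar ∧
    (∀ a : S.Mbar, (Set.range fun m : S.Mbar => m + a) ⊆ Set.range fun m : S.Mbar => a + m) ∧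
    (∀ a b : S.Mbar, S.phiBar a b = S.lamBar a b) ∧
    (∀ a b : S.Mbar, (∃! c : S.Mbar, a + b = b + c) ∧ a + b = b + S.cBar a b) ∧
    YangBaxter.IsSolution S.rBar ∧
    YangBaxter.IsLeftNondegenerate S.rBar ∧
    ∃ s : S.Xbar × S.Xbar → S.Xbar × S.Xbar,
      (∀ x y : S.Xbar, S.rBar (x, y) = (((s (x, y)).1 : S.Mbar), ((s (x, y)).2 : S.Mbar))) ∧
      YangBaxter.IsSolution s ∧ YangBaxter.IsLeftNondegenerate s := by
  refine ⟨S.isLeftSemiTruss_Mbar, ?_, fun _ _ => rfl, fun a b => ⟨?_, (S.add_cBar a b).symm⟩,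
    S.isSolution_rBar, S.isLeftNondegenerate_rBar, S.rBarRestrict, fun _ _ => rfl,
    S.isSolution_rBar.of_injective Subtype.val Subtype.val_injective fun _ _ => rfl,
    S.isLeftNondegenerate_rBarRestrict⟩
  · rintro a _ ⟨m, rfl⟩
    exact ⟨S.cBar m a, S.add_cBar m a⟩
  · exact ⟨S.cBar a b, (S.add_cBar a b).symm, fun c hc => (S.cBar_eq hc).symm⟩
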